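/- Let $d,m,N$ be positive integers, let $A_1,\dots,A_N\in\mathcal M_{d,d}(\mathbb R)$ and $B\in\mathcal M_{d,m}(\mathbb R)$, and let $0<\Lambda_1<\dots<\Lambda_N$ be real numbers. Consider the linear difference delay system $$x(t)=\sum_{j=1}^N A_j\,x(t-\Lambda_j)+B\,u(t),\qquad t\ge 0. \tag{1}$$ For $T>0$, $u\in L^1([0,T],\mathbb R^m)$ and $x_0\in L^1([-\Lambda_N,0],\mathbb R^d)$, the associated solution is the unique $x\in L^1([-\Lambda_N,T],\mathbb R^d)$ with $x(\theta)=x_0(\theta)$ for almost every $\theta\in[-\Lambda_N,0]$ that satisfies (1) for almost every $t\in[0,T]$. System (1) is called $L^1$ exactly controllable in time $T$ if for all $x_0,\phi\in L^1([-\Lambda_N,0],\mathbb R^d)$ there exists $u\in L^1([0,T],\mathbb R^m)$ such that the associated solution satisfies $x(T+\theta)=\phi(\theta)$ for almost every $\theta\in[-\Lambda_N,0]$. Define $$H(p)=I_d-\sum_{j=1}^N e^{-p\Lambda_j}A_j,\qquad p\in\mathbb C,$$ let $\overline{H(\mathbb C)}$ be the closure of $\{H(p): p\in\mathbb C\}$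 in $\mathcal M_{d,d}(\mathbb C)$, and let $[M,B]$ denote the juxtaposition of the matrices $M$ and $B$. Theorem. If System (1) is $L^1$ exactly controllable in time $d\Lambda_N$, then the following two conditions hold: (i) $\operatorname{rank}[M,B]=d$ for every $M\in\overline{H(\mathbb C)}$; (ii) $\operatorname{rank}[A_N,B]=d$. -/

import Mathlib

open MeasureTheory Set

namespace DifferenceDelay

/-- The last index `N` of the index set `{1, …, N}`, the latter being modelled by `Fin N`. -/
def lastIdx (N : ℕ) [NeZero N] : Fin N :=
  ⟨N - 1, Nat.sub_lt (NeZero.pos N) Nat.one_pos⟩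

/-- `x` is the `L^q` solution on `[-Λ_N, T]` of the difference delay equation
`x(t) = ∑ j, A_j x(t - Λ_j) + B u(t)`, `t ∈ [0, T]`, with initial state `x₀` on `[-Λ_N, 0]`.
Elements of `L^q` are represented by functions, and equalities between them hold almost
everywhere. -/
def IsSolution {d m N : ℕ} [NeZero N] (q : ENNReal)
    (A : Fin N → Matrix (Fin d) (Fin d) ℝ) (Λ : Fin N → ℝ) (B : Matrix (Fin d) (Fin m) ℝ)
    (T : ℝ) (x₀ : ℝ → (Fin d → ℝ)) (u : ℝ → (Fin m → ℝ)) (x : ℝ → (Fin d → ℝ)) : Prop :=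
  MemLp x q (volume.restrict (Icc (-Λ (lastIdx N)) T)) ∧
  (∀ᵐ θ ∂(volume.restrict (Icc (-Λ (lastIdx N)) 0)), x θ = x₀ θ) ∧
  (∀ᵐ t ∂(volume.restrict (Icc 0 T)),
    x t = (∑ j, (A j).mulVec (x (t - Λ j))) + B.mulVec (u t))

/-- The system is `L^q` exactly controllable in time `T`: for all `x₀, φ ∈ L^q([-Λ_N, 0], ℝ^d)`
there is a control `u ∈ L^q([0, T], ℝ^m)` such that the solution `x` with initial state `x₀`
satisfies `x_T = φ`, where `x_T(θ) = x(T + θ)` for `θ ∈ [-Λ_N, 0]`. -/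
def ExactlyControllable {d m N : ℕ} [NeZero N] (q : ENNReal)
    (A : Fin N → Matrix (Fin d) (Fin d) ℝ) (Λ : Fin N → ℝ) (B : Matrix (Fin d) (Fin m) ℝ)
    (T : ℝ) : Prop :=
  ∀ x₀ φ : ℝ → (Fin d → ℝ),
    MemLp x₀ q (volume.restrict (Icc (-Λ (lastIdx N)) 0)) →
    MemLp φ q (volume.restrict (Icc (-Λ (lastIdx N)) 0)) →
    ∃ u : ℝ → (Fin m → ℝ), MemLp u q (volume.restrict (Icc 0 T)) ∧
      ∃ x : ℝ → (Fin d → ℝ), IsSolution q A Λ B T x₀ u x ∧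
        ∀ᵐ θ ∂(volume.restrict (Icc (-Λ (lastIdx N)) 0)), x (T + θ) = φ θ

/-- The matrix-valued holomorphic map `H(p) = I_d - ∑ j, e^{-p Λ_j} A_j`, `p ∈ ℂ`. -/
noncomputable def H {d N : ℕ} (A : Fin N → Matrix (Fin d) (Fin d) ℝ) (Λ : Fin N → ℝ) (p : ℂ) :
    Matrix (Fin d) (Fin d) ℂ :=
  1 - ∑ j, Complex.exp (-p * (Λ j : ℂ)) • (A j).map (fun r : ℝ => (r : ℂ))

end DifferenceDelay

namespace DifferenceDelay

/-! Full row rank means that a common left null vector `w` of both blocks vanishes, and each such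
`w` obstructs some final state. For (ii), ask for a final state equal to `w` just before time `T`
and zero earlier in the window. The shorter delays then see zero, and `w` kills the longest delay
and the control, so `w ⬝ᵥ w = 0`. For (i), start from zero and reach `f` in coordinate `k`, with `f`
supported near the right end. With `X` the Laplace integral of the trajectory over `[0, T]` and `w B
= 0`, `sub_vecMul_H_mul_integral` shows that `w H(p) X` is `-e^{-pT} (w_k - (w H(p))_k) ∫ e^{-pθ}
f`. Hence `w H(p)` controls the right side, with a constant depending on `f` but not on `p`.
Banach–Steinhaus and exponential test functions remove `f` (`exists_norm_sub_vecMul_H_le`). If `w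
H(p)` tends to 0 along some points `p`, their real parts stay bounded above because `H(p)` tends to
the identity on the right; the estimate then forces `w_k = 0`. Uniformity in `p` is what reaches the
closure. -/

/-- A matrix juxtaposition has full row rank if no nonzero row vector annihilates both blocks. -/
theorem rank_fromCols_eq {K : Type*} [Field K] {d m : ℕ} (M : Matrix (Fin d) (Fin d) K)
    (B : Matrix (Fin d) (Fin m) K)
    (h : ∀ w : Fin d → K, Matrix.vecMul w M = 0 → Matrix.vecMul w B = 0 → w = 0) :
    (Matrix.fromCols M B).rank = d := by
  have hli : LinearIndependent K (Matrix.fromCols M B).row := by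
    rw [← Matrix.vecMul_injective_iff]
    refine (injective_iff_map_eq_zero (Matrix.vecMulLinear (Matrix.fromCols M B))).2 fun w hw ↦ ?_
    rw [Matrix.vecMulLinear_apply, Matrix.vecMul_fromCols] at hw
    refine h w (funext fun i ↦ ?_) (funext fun i ↦ ?_)
    · exact congrFun hw (Sum.inl i)
    · exact congrFun hw (Sum.inr i)
  simpa using hli.rank_matrix

theorem le_lastIdx {N : ℕ} [NeZero N] (j : Fin N) : j ≤ lastIdx N := by
  have := j.2
  simp only [Fin.le_def, lastIdx]
  omega

/-! ### Truncated Laplace transform of a delayed function. -/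

/-- Laplace transform on `[0, T]` of a delayed function that vanishes on `[-L, 0]` and is equal to
the translate of `g` on `[T - L, T]`. -/
theorem integral_exp_mul_shift {L T l : ℝ} (p : ℂ) {h g : ℝ → ℂ} (hl : 0 ≤ l) (hlL : l ≤ L)
    (hT : 0 ≤ T) (hh : IntegrableOn h (Icc (-L) T))
    (h0 : ∀ᵐ θ ∂(volume.restrict (Icc (-L) 0)), h θ = 0)
    (hg : ∀ᵐ θ ∂(volume.restrict (Icc (-L) 0)), h (T + θ) = g θ) :
    ∫ t in (0 : ℝ)..T, Complex.exp (-p * t) * h (t - l) =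
      Complex.exp (-p * l) * ((∫ t in (0 : ℝ)..T, Complex.exp (-p * t) * h t) -
        Complex.exp (-p * T) * ∫ θ in (-l)..0, Complex.exp (-p * θ) * g θ) := by
  set E : ℝ → ℂ := fun t ↦ Complex.exp (-p * t) * h t with hE
  have hEint : IntegrableOn E (Icc (-L) T) :=
    hh.continuousOn_mul (by fun_prop) isCompact_Icc
  have hii : ∀ a b, -L ≤ a → a ≤ T → -L ≤ b → b ≤ T → IntervalIntegrable E volume a b := by
    intro a b h1 h2 h3 h4
    refine (hEint.mono_set ?_).intervalIntegrable
    intro t ht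
    rw [mem_uIcc] at ht
    constructor <;> rcases ht with ht | ht <;> linarith [ht.1, ht.2]
  have hmono : ∀ {P : ℝ → Prop}, (∀ᵐ θ ∂(volume.restrict (Icc (-L) 0)), P θ) →
      ∀ᵐ θ, θ ∈ uIoc (-l) 0 → P θ := by
    intro P hP
    rw [ae_restrict_iff' measurableSet_Icc] at hP
    filter_upwards [hP] with θ hθ hθ'
    rw [uIoc_of_le (by linarith)] at hθ'
    exact hθ ⟨by linarith [hθ'.1], hθ'.2⟩
  have e1 : ∫ t in (0 : ℝ)..T, Complex.exp (-p * t) * h (t - l) =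
      Complex.exp (-p * l) * ∫ t in (0 : ℝ)..T, E (t - l) := by
    rw [← intervalIntegral.integral_const_mul]
    congr 1
    funext t
    simp only [hE]
    rw [← mul_assoc, ← Complex.exp_add]
    congr 2
    push_cast
    ring
  have e2 : ∫ t in (-l)..0, E t = 0 := by
    rw [intervalIntegral.integral_congr_ae (g := fun _ ↦ 0) ?_]
    · simp
    · filter_upwards [hmono h0] with θ hθ hm
      simp [hE, hθ hm]
  have e3 : ∫ t in (T - l)..T, E t =
      Complex.exp (-p * T) * ∫ θ in (-l)..0, Complex.exp (-p * θ) * g θ := by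
    have : ∫ θ in (-l)..0, E (T + θ) = ∫ t in (T - l)..T, E t := by
      rw [intervalIntegral.integral_comp_add_left]
      simp [sub_eq_add_neg]
    rw [← this, ← intervalIntegral.integral_const_mul]
    refine intervalIntegral.integral_congr_ae ?_
    filter_upwards [hmono hg] with θ hθ hm
    simp only [hE]
    rw [hθ hm, ← mul_assoc, ← Complex.exp_add]
    congr 2
    push_cast
    ring
  -- The delay moves the window to `[-l, T - l]`: compared with `[0, T]` it gains the zero initial
  -- piece and loses the prescribed final piece.
  have e4 : ∫ t in (-l)..(T - l), E t =
      (∫ t in (-l)..0, E t) + (∫ t in (0:ℝ)..T, E t) - ∫ t in (T - l)..T, E t := by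
    have a1 := intervalIntegral.integral_add_adjacent_intervals
      (hii (-l) 0 (by linarith) (by linarith) (by linarith) hT)
      (hii 0 T (by linarith) hT (by linarith) le_rfl)
    have a2 := intervalIntegral.integral_add_adjacent_intervals
      (hii (-l) (T - l) (by linarith) (by linarith) (by linarith) (by linarith))
      (hii (T - l) T (by linarith) (by linarith) (by linarith) le_rfl)
    rw [a1, ← a2]
    ring
  rw [e1, intervalIntegral.integral_comp_sub_right, zero_sub, e4, e2, e3, zero_add]

/-! ### Condition (ii). -/

/-- If the last delay matrix and the input matrix have a common left null vector, then final states
are constrained near their right end. -/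
theorem vecMul_eq_zero_of_controllable {d m N : ℕ} [NeZero N]
    {A : Fin N → Matrix (Fin d) (Fin d) ℝ} {B : Matrix (Fin d) (Fin m) ℝ}
    {Λ : Fin N → ℝ} (hpos : ∀ j, 0 < Λ j) (hmono : StrictMono Λ) {T : ℝ}
    (hT : Λ (lastIdx N) ≤ T) (hctrl : ExactlyControllable 1 A Λ B T) (w : Fin d → ℝ)
    (hA : Matrix.vecMul w (A (lastIdx N)) = 0) (hB : Matrix.vecMul w B = 0) : w = 0 := by
  set L := Λ (lastIdx N) with hL
  have hL0 : 0 < L := hpos _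
  obtain ⟨ε, hε0, hεL, hε⟩ : ∃ ε : ℝ, 0 < ε ∧ ε ≤ L ∧
      ∀ j, ε ≤ Λ j ∧ (j ≠ lastIdx N → ε ≤ L - Λ j) := by
    -- Finitely many strict inequalities, so every small positive `ε` works.
    have key : ∀ᶠ ε : ℝ in nhdsWithin 0 (Ioi 0), ∀ j, ε ≤ Λ j ∧ (j ≠ lastIdx N → ε ≤ L - Λ j) := by
      rw [Filter.eventually_all]
      intro j
      refine Filter.Eventually.and ?_ ?_
      · exact Filter.Eventually.filter_mono nhdsWithin_le_nhds (eventually_le_nhds (hpos j))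
      · by_cases hj : j = lastIdx N
        · simp [hj]
        · have : 0 < L - Λ j := sub_pos.2 (hmono (lt_of_le_of_ne (le_lastIdx j) hj))
          exact (Filter.Eventually.filter_mono nhdsWithin_le_nhds
            (eventually_le_nhds this)).mono fun _ h _ ↦ h
    obtain ⟨ε, h1, h2⟩ := (key.and self_mem_nhdsWithin).exists
    exact ⟨ε, h2, (h1 (lastIdx N)).1, h1⟩
  let φ : ℝ → Fin d → ℝ := (Ioc (-ε) 0).indicator fun _ ↦ w
  obtain ⟨u, -, x, ⟨-, -, hx⟩, hxT⟩ := hctrl 0 φ MemLp.zero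
    ((memLp_const w).indicator measurableSet_Ioc)
  rw [ae_restrict_iff' measurableSet_Icc] at hx hxT
  -- All almost-everywhere statements are rewritten in the single variable `θ`, so that one common
  -- `θ` can be picked in `(-ε, 0)`.
  have hx' : ∀ᵐ θ : ℝ, T + θ ∈ Icc 0 T →
      x (T + θ) = (∑ j, (A j).mulVec (x (T + θ - Λ j))) + B.mulVec (u (T + θ)) :=
    (measurePreserving_add_left volume T).quasiMeasurePreserving.ae hx
  have hxj : ∀ᵐ θ : ℝ, ∀ j, θ - Λ j ∈ Icc (-L) 0 → x (T + (θ - Λ j)) = φ (θ - Λ j) := by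
    rw [ae_all_iff]
    intro j
    exact (measurePreserving_sub_right volume (Λ j)).quasiMeasurePreserving.ae hxT
  have hall := hx'.and (hxj.and hxT)
  have hpo : volume (Ioo (-ε) 0) ≠ 0 := by simp [hε0]
  obtain ⟨θ, hθ, h1, h2, h3⟩ : ∃ θ ∈ Ioo (-ε) 0, _ :=
    (frequently_ae_mem_iff.2 hpo |>.and_eventually hall).exists
  have h3' := h3 ⟨by linarith [hθ.1], hθ.2.le⟩
  have hφ : φ θ = w := indicator_of_mem (s := Ioc (-ε) 0) ⟨hθ.1, hθ.2.le⟩ _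
  have h1' := h1 ⟨by linarith [hθ.1], by linarith [hθ.2]⟩
  rw [h3', hφ] at h1'
  have hsum : ∀ j, w ⬝ᵥ (A j).mulVec (x (T + θ - Λ j)) = 0 := by
    intro j
    by_cases hj : j = lastIdx N
    · rw [Matrix.dotProduct_mulVec, hj, hA, zero_dotProduct]
    -- By the choice of `ε`, `θ - Λ j` stays in the final window but lies left of `-ε`, where `φ`
    -- vanishes.
    · have := h2 j ⟨by linarith [hθ.1, (hε j).2 hj], by linarith [hθ.2, hpos j]⟩
      rw [add_sub_assoc, this]
      have hz : φ (θ - Λ j) = 0 := indicator_of_notMem (s := Ioc (-ε) 0)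
        (fun hm ↦ by linarith [hm.1, hθ.2, (hε j).1]) _
      rw [hz, Matrix.mulVec_zero, dotProduct_zero]
  have hww := congrArg (fun v ↦ w ⬝ᵥ v) h1'
  simp only [dotProduct_add, dotProduct_sum, hsum, Finset.sum_const_zero,
    Matrix.dotProduct_mulVec w B, hB, zero_dotProduct, add_zero] at hww
  exact dotProduct_self_eq_zero.1 hww

/-! ### Laplace identity along a left null vector of `B`. -/

theorem vecMul_H {d N : ℕ} (A : Fin N → Matrix (Fin d) (Fin d) ℝ) (Λ : Fin N → ℝ) (w : Fin d → ℂ)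
    (p : ℂ) (i : Fin d) :
    Matrix.vecMul w (H A Λ p) i = w i - ∑ j, Complex.exp (-p * Λ j) *
      Matrix.vecMul w ((A j).map (fun r : ℝ ↦ (r : ℂ))) i := by
  simp [H, Matrix.vecMul_sub, Matrix.vecMul_sum, Matrix.vecMul_smul, Finset.sum_apply]

theorem dotProduct_ofReal_mulVec {d n : ℕ} (M : Matrix (Fin d) (Fin n) ℝ) (w : Fin d → ℂ)
    (y : Fin n → ℝ) :
    ∑ i, w i * ((M.mulVec y i : ℝ) : ℂ) =
      ∑ i, Matrix.vecMul w (M.map (fun r : ℝ ↦ (r : ℂ))) i * (y i : ℂ) := by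
  have h := Matrix.dotProduct_mulVec w (M.map (fun r : ℝ ↦ (r : ℂ))) (fun i ↦ (y i : ℂ))
  simp only [dotProduct] at h
  rw [← h]
  refine Finset.sum_congr rfl fun i _ ↦ ?_
  simp [Matrix.mulVec, dotProduct]

/-- Laplace transform of a trajectory starting at zero whose final state is concentrated in the
`k`-th coordinate and near the right end, along a left null vector of the input matrix. -/
theorem sub_vecMul_H_mul_integral {d m N : ℕ} [NeZero N]
    {A : Fin N → Matrix (Fin d) (Fin d) ℝ} {B : Matrix (Fin d) (Fin m) ℝ}
    {Λ : Fin N → ℝ} (hmono : StrictMono Λ) {T ε : ℝ} (hε : 0 ≤ ε) (hεΛ : ∀ j, ε ≤ Λ j)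
    (hT : Λ (lastIdx N) ≤ T) {w : Fin d → ℂ}
    (hB : Matrix.vecMul w (B.map (fun r : ℝ ↦ (r : ℂ))) = 0) (k : Fin d) (f : ℝ → ℝ)
    {u : ℝ → Fin m → ℝ} {x : ℝ → Fin d → ℝ} (hx : IsSolution 1 A Λ B T 0 u x)
    (hxT : ∀ᵐ θ ∂(volume.restrict (Icc (-Λ (lastIdx N)) 0)),
      x (T + θ) = Pi.single k ((Icc (-ε) 0).indicator f θ)) (p : ℂ) :
    (w k - Matrix.vecMul w (H A Λ p) k) *
        ∫ θ in Icc (-ε) 0, Complex.exp (-p * θ) * (f θ : ℂ) =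
      -(Complex.exp (p * T) * ∑ i, Matrix.vecMul w (H A Λ p) i *
        ∫ t in (0 : ℝ)..T, Complex.exp (-p * t) * (x t i : ℂ)) := by
  obtain ⟨hx1, hx0, hxe⟩ := hx
  set L := Λ (lastIdx N) with hL
  have hL0 : 0 ≤ L := hε.trans (hεΛ _)
  have hT0 : 0 ≤ T := hL0.trans hT
  have hΛ0 : ∀ j, 0 ≤ Λ j := fun j ↦ hε.trans (hεΛ j)
  have hΛL : ∀ j, Λ j ≤ L := fun j ↦ hmono.monotone (le_lastIdx j)
  set a : Fin N → Fin d → ℂ := fun j ↦ Matrix.vecMul w ((A j).map (fun r : ℝ ↦ (r : ℂ))) with ha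
  set I := ∫ θ in Icc (-ε) 0, Complex.exp (-p * θ) * (f θ : ℂ) with hI
  set X : Fin d → ℂ := fun i ↦ ∫ t in (0 : ℝ)..T, Complex.exp (-p * t) * (x t i : ℂ) with hX
  have hint : ∀ i, IntegrableOn (fun t ↦ (x t i : ℂ)) (Icc (-L) T) := fun i ↦
    ((memLp_one_iff_integrable.1 hx1).eval i).ofReal
  have hint' : ∀ i l, 0 ≤ l → l ≤ L →
      IntervalIntegrable (fun t : ℝ ↦ Complex.exp (-p * t) * (x (t - l) i : ℂ)) volume 0 T := by
    intro i l h0 h1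
    have h2 : IntervalIntegrable (fun t ↦ (x t i : ℂ)) volume (0 - l) (T - l) := by
      refine ((hint i).mono_set ?_).intervalIntegrable
      rw [uIcc_of_le (by linarith)]
      exact Icc_subset_Icc (by linarith) (by linarith)
    have h3 := h2.comp_sub_right l
    simp only [sub_add_cancel] at h3
    exact h3.continuousOn_mul (by fun_prop)
  -- Since `ε ≤ Λ j`, the support of the final state lies in every `[-Λ j, 0]`, so the same `I`
  -- appears for all delays.
  have hshift : ∀ i j, ∫ t in (0 : ℝ)..T, Complex.exp (-p * t) * (x (t - Λ j) i : ℂ) =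
      Complex.exp (-p * Λ j) * (X i - Complex.exp (-p * T) * if i = k then I else 0) := by
    intro i j
    rw [integral_exp_mul_shift (L := L) (g := fun θ ↦
        (((Pi.single k ((Icc (-ε) 0).indicator f θ) : Fin d → ℝ) i : ℝ) : ℂ)) p (hΛ0 j) (hΛL j)
        hT0 (hint i)]
    · congr 3
      split_ifs with hik
      · subst hik
        rw [hI, intervalIntegral.integral_of_le (by linarith [hΛ0 j]),
          ← integral_Icc_eq_integral_Ioc, ← inter_eq_self_of_subset_right
            (Icc_subset_Icc_left (neg_le_neg (hεΛ j)) : Icc (-ε) 0 ⊆ Icc (-Λ j) 0),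
          ← setIntegral_indicator measurableSet_Icc]
        congr 1
        funext θ
        rw [inter_eq_self_of_subset_right
            (Icc_subset_Icc_left (neg_le_neg (hεΛ j)) : Icc (-ε) 0 ⊆ Icc (-Λ j) 0)]
        by_cases hθ : θ ∈ Icc (-ε) 0 <;> simp [hθ]
      · simp [Pi.single_eq_of_ne hik]
    · filter_upwards [hx0] with θ hθ
      simp [hθ]
    · filter_upwards [hxT] with θ hθ
      rw [hθ]
  -- Pairing the equation with `w` eliminates the control.
  have hpt : ∀ᵐ t ∂(volume.restrict (Icc 0 T)), ∑ i, w i * (x t i : ℂ) =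
      ∑ j, ∑ i, a j i * (x (t - Λ j) i : ℂ) := by
    filter_upwards [hxe] with t ht
    have h1 : ∀ i, (x t i : ℂ) = (∑ j, (((A j).mulVec (x (t - Λ j)) i : ℝ) : ℂ)) +
        ((B.mulVec (u t) i : ℝ) : ℂ) := by
      intro i
      have := congrFun ht i
      rw [this]
      simp
    simp only [h1, mul_add, Finset.sum_add_distrib, dotProduct_ofReal_mulVec, hB, Finset.mul_sum]
    rw [Finset.sum_comm]
    simp only [dotProduct_ofReal_mulVec, ha]
    simp
  have hmain : ∑ i, w i * X i = ∑ j, ∑ i, a j i *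
      ∫ t in (0 : ℝ)..T, Complex.exp (-p * t) * (x (t - Λ j) i : ℂ) := by
    have h1 : ∑ i, w i * X i = ∫ t in (0 : ℝ)..T, ∑ i, w i * (Complex.exp (-p * t) * (x t i : ℂ)) := by
      rw [intervalIntegral.integral_finsetSum]
      · simp [hX]
      · intro i _
        have := hint' i 0 le_rfl hL0
        simp only [sub_zero] at this
        exact this.const_mul _
    have h2 : ∑ j, ∑ i, a j i * ∫ t in (0 : ℝ)..T, Complex.exp (-p * t) * (x (t - Λ j) i : ℂ) =
        ∫ t in (0 : ℝ)..T, ∑ j, ∑ i, a j i * (Complex.exp (-p * t) * (x (t - Λ j) i : ℂ)) := by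
      have h3 : ∀ j i, IntervalIntegrable
          (fun t : ℝ ↦ a j i * (Complex.exp (-p * t) * (x (t - Λ j) i : ℂ))) volume 0 T :=
        fun j i ↦ (hint' i _ (hΛ0 j) (hΛL j)).const_mul _
      rw [intervalIntegral.integral_finsetSum]
      · refine Finset.sum_congr rfl fun j _ ↦ ?_
        rw [intervalIntegral.integral_finsetSum fun i _ ↦ h3 j i]
        simp
      · intro j _
        have := IntervalIntegrable.sum Finset.univ fun i _ ↦ h3 j i
        rw [Finset.sum_fn] at this
        exact this
    rw [h1, h2]
    refine intervalIntegral.integral_congr_ae ?_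
    rw [ae_restrict_iff' measurableSet_Icc] at hpt
    filter_upwards [hpt] with t ht hm
    rw [uIoc_of_le hT0] at hm
    have := congrArg (fun z ↦ Complex.exp (-p * t) * z) (ht ⟨hm.1.le, hm.2⟩)
    simpa only [Finset.mul_sum, mul_left_comm] using this
  simp only [hshift] at hmain
  have hexp : Complex.exp (p * T) * Complex.exp (-p * T) = 1 := by
    rw [← Complex.exp_add]
    simp
  have hH : ∀ i, Matrix.vecMul w (H A Λ p) i = w i - ∑ j, Complex.exp (-p * Λ j) * a j i :=
    vecMul_H A Λ w p
  have hsum : ∑ i, Matrix.vecMul w (H A Λ p) i * X i =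
      -(Complex.exp (-p * T) * ((∑ j, Complex.exp (-p * Λ j) * a j k) * I)) := by
    have h1 : ∑ j, ∑ i, a j i * (Complex.exp (-p * Λ j) *
        (X i - Complex.exp (-p * T) * if i = k then I else 0)) =
        ∑ i, (∑ j, Complex.exp (-p * Λ j) * a j i) * X i -
        Complex.exp (-p * T) * ((∑ j, Complex.exp (-p * Λ j) * a j k) * I) := by
      rw [Finset.sum_comm]
      have h2 : ∀ i, ∑ j, a j i * (Complex.exp (-p * Λ j) *
          (X i - Complex.exp (-p * T) * if i = k then I else 0)) =
          (∑ j, Complex.exp (-p * Λ j) * a j i) * X i -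
          if i = k then Complex.exp (-p * T) * ((∑ j, Complex.exp (-p * Λ j) * a j i) * I)
            else 0 := by
        intro i
        split_ifs
        · rw [Finset.sum_mul, Finset.sum_mul, Finset.mul_sum, ← Finset.sum_sub_distrib]
          exact Finset.sum_congr rfl fun j _ ↦ by ring
        · rw [Finset.sum_mul, sub_zero]
          exact Finset.sum_congr rfl fun j _ ↦ by ring
      simp only [h2, Finset.sum_sub_distrib]
      simp
    simp only [hH, sub_mul, Finset.sum_sub_distrib, hmain, h1]
    ring
  rw [hsum, hH k]
  linear_combination (-(∑ j, Complex.exp (-p * Λ j) * a j k) * I) * hexp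

/-- Bound of the Laplace transform over `[0, T]`, normalized at the right end, by the `L¹` norm,
uniformly in the frequency. -/
theorem norm_exp_mul_integral_le {T : ℝ} (hT : 0 ≤ T) {h : ℝ → ℂ}
    (hh : IntervalIntegrable h volume 0 T) (p : ℂ) :
    ‖Complex.exp (p * T) * ∫ t in (0 : ℝ)..T, Complex.exp (-p * t) * h t‖ ≤
      max 1 (Real.exp (p.re * T)) * ∫ t in (0 : ℝ)..T, ‖h t‖ := by
  rw [← intervalIntegral.integral_const_mul, ← intervalIntegral.integral_const_mul]
  refine intervalIntegral.norm_integral_le_of_norm_le hT ?_ (hh.norm.const_mul _)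
  refine Filter.Eventually.of_forall fun t ht ↦ ?_
  rw [← mul_assoc, ← Complex.exp_add, norm_mul, Complex.norm_exp]
  refine mul_le_mul_of_nonneg_right ?_ (norm_nonneg _)
  -- As `0 ≤ T - t ≤ T`, the exponential is at most 1 or at most `e^{Re p · T}`, according to the
  -- sign of `Re p`.
  have : (p * T + -p * t).re = p.re * (T - t) := by simp; ring
  rw [this]
  rcases le_total p.re 0 with hp | hp
  · exact le_max_of_le_left (Real.exp_le_one_iff.2
      (mul_nonpos_of_nonpos_of_nonneg hp (by linarith [ht.2])))
  · refine le_max_of_le_right (Real.exp_le_exp.2 ?_)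
    exact mul_le_mul_of_nonneg_left (by linarith [ht.1]) hp

/-! ### Uniform estimate in the frequency. -/

/-- The pairing of an integrable function on `[-ε, 0]` with the exponential `e^{-pθ}`. -/
noncomputable def expPairing (ε : ℝ) (p : ℂ) :
    Lp ℂ 1 (volume.restrict (Icc (-ε) 0)) →L[ℂ] ℂ :=
  LinearMap.mkContinuous
    { toFun := fun f ↦ ∫ θ in Icc (-ε) 0, Complex.exp (-p * θ) * f θ
      map_add' := fun f g ↦ by
        have hi : ∀ h : Lp ℂ 1 (volume.restrict (Icc (-ε) 0)),
            IntegrableOn (fun θ : ℝ ↦ Complex.exp (-p * θ) * h θ) (Icc (-ε) 0) := fun h ↦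
          IntegrableOn.continuousOn_mul (by fun_prop) (L1.integrable_coeFn h) isCompact_Icc
        rw [← integral_add (hi f) (hi g)]
        refine integral_congr_ae ?_
        filter_upwards [Lp.coeFn_add f g] with θ hθ
        rw [hθ, Pi.add_apply, mul_add]
      map_smul' := fun c f ↦ by
        rw [RingHom.id_apply, smul_eq_mul, ← integral_const_mul]
        refine integral_congr_ae ?_
        filter_upwards [Lp.coeFn_smul c f] with θ hθ
        rw [hθ, Pi.smul_apply, smul_eq_mul, mul_left_comm] }
    (Real.exp (|p.re| * ε)) (fun f ↦ by
      rw [L1.norm_eq_integral_norm, ← integral_const_mul]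
      refine norm_integral_le_of_norm_le ((L1.integrable_coeFn f).norm.const_mul _) ?_
      filter_upwards [ae_restrict_mem measurableSet_Icc] with θ hθ
      rw [norm_mul, Complex.norm_exp]
      refine mul_le_mul_of_nonneg_right (Real.exp_le_exp.2 ?_) (norm_nonneg _)
      have h1 : (-p * θ).re = p.re * -θ := by simp
      rw [h1]
      exact mul_le_mul (le_abs_self _) (by linarith [hθ.1]) (by linarith [hθ.2]) (abs_nonneg _))

theorem expPairing_apply (ε : ℝ) (p : ℂ) (f : Lp ℂ 1 (volume.restrict (Icc (-ε) 0))) :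
    expPairing ε p f = ∫ θ in Icc (-ε) 0, Complex.exp (-p * θ) * f θ := rfl

/-- The pairings with exponentials are bounded below on functions with small support, uniformly
in the frequency. -/
theorem exists_le_norm_expPairing {ε : ℝ} (hε : 0 < ε) (p : ℂ) :
    ∃ f, 0 < ‖expPairing ε p f‖ ∧ ‖f‖ ≤ Real.exp 1 * ‖expPairing ε p f‖ := by
  -- The test function `e^{pθ}` on `[-δ, 0]` pairs to exactly `δ`; a length of order `1 / (1 + |Re
  -- p|)` keeps its modulus at most `e`.
  set δ := min ε (1 / (1 + |p.re|)) with hδ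
  have hp : 0 < 1 + |p.re| := by positivity
  have hδ0 : 0 < δ := lt_min hε (by positivity)
  have hsub : Icc (-δ) 0 ⊆ Icc (-ε) 0 := Icc_subset_Icc_left (neg_le_neg (min_le_left _ _))
  have hδp : |p.re| * δ ≤ 1 := by
    have h1 : δ * (1 + |p.re|) ≤ 1 := (le_div_iff₀ hp).1 (min_le_right _ _)
    nlinarith
  have hint : IntegrableOn (fun θ : ℝ ↦ Complex.exp (p * θ)) (Icc (-δ) 0) :=
    ContinuousOn.integrableOn_compact isCompact_Icc (by fun_prop)
  have hmem : MemLp ((Icc (-δ) 0).indicator fun θ : ℝ ↦ Complex.exp (p * θ)) 1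
      (volume.restrict (Icc (-ε) 0)) :=
    memLp_one_iff_integrable.2 ((integrable_indicator_iff measurableSet_Icc).2 hint).integrableOn
  have hval : expPairing ε p (hmem.toLp _) = (δ : ℂ) := by
    rw [expPairing_apply]
    have h1 : ∫ θ in Icc (-ε) 0, Complex.exp (-p * θ) * (hmem.toLp _ : ℝ → ℂ) θ =
        ∫ θ in Icc (-ε) 0, (Icc (-δ) 0).indicator (fun _ ↦ (1 : ℂ)) θ := by
      refine integral_congr_ae ?_
      filter_upwards [hmem.coeFn_toLp] with θ hθ
      rw [hθ]
      by_cases hm : θ ∈ Icc (-δ) 0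
      · rw [indicator_of_mem hm, indicator_of_mem hm, ← Complex.exp_add]
        simp
      · rw [indicator_of_notMem hm, indicator_of_notMem hm, mul_zero]
    rw [h1, setIntegral_indicator measurableSet_Icc, inter_eq_self_of_subset_right hsub]
    simp [hδ0.le]
  have hnorm : ‖expPairing ε p (hmem.toLp _)‖ = δ := by
    rw [hval, Complex.norm_real, Real.norm_of_nonneg hδ0.le]
  refine ⟨hmem.toLp _, hδ0.trans_eq hnorm.symm, ?_⟩
  rw [hnorm, L1.norm_eq_integral_norm]
  calc ∫ θ in Icc (-ε) 0, ‖(hmem.toLp _ : ℝ → ℂ) θ‖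
      ≤ ∫ θ in Icc (-ε) 0, (Icc (-δ) 0).indicator (fun _ ↦ Real.exp 1) θ := by
        refine integral_mono_ae (L1.integrable_coeFn _).norm
          ((integrable_const _).indicator measurableSet_Icc) ?_
        filter_upwards [hmem.coeFn_toLp] with θ hθ
        rw [hθ]
        by_cases hm : θ ∈ Icc (-δ) 0
        · rw [indicator_of_mem hm, indicator_of_mem hm, Complex.norm_exp]
          refine Real.exp_le_exp.2 ?_
          have h1 : (p * θ).re = -p.re * -θ := by simp
          rw [h1]
          refine le_trans ?_ hδp
          exact mul_le_mul (neg_le_abs _) (by linarith [hm.1]) (by linarith [hm.2]) (abs_nonneg _)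
        · rw [indicator_of_notMem hm, indicator_of_notMem hm, norm_zero]
    _ = Real.exp 1 * δ := by
        rw [setIntegral_indicator measurableSet_Icc, inter_eq_self_of_subset_right hsub]
        simp [hδ0.le, mul_comm]

/-- Pointwise bound for a real final state. -/
theorem exists_norm_sub_vecMul_H_mul_integral_le {d m N : ℕ} [NeZero N]
    {A : Fin N → Matrix (Fin d) (Fin d) ℝ} {B : Matrix (Fin d) (Fin m) ℝ}
    {Λ : Fin N → ℝ} (hmono : StrictMono Λ) {T ε : ℝ} (hε : 0 ≤ ε) (hεΛ : ∀ j, ε ≤ Λ j)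
    (hT : Λ (lastIdx N) ≤ T) (hctrl : ExactlyControllable 1 A Λ B T) {w : Fin d → ℂ}
    (hB : Matrix.vecMul w (B.map (fun r : ℝ ↦ (r : ℂ))) = 0) (k : Fin d) {f : ℝ → ℝ}
    (hf : IntegrableOn f (Icc (-ε) 0)) :
    ∃ K : ℝ, ∀ p : ℂ, ‖(w k - Matrix.vecMul w (H A Λ p) k) *
        ∫ θ in Icc (-ε) 0, Complex.exp (-p * θ) * (f θ : ℂ)‖ ≤
      max 1 (Real.exp (p.re * T)) * (∑ i, ‖Matrix.vecMul w (H A Λ p) i‖) * K := by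
  have hT0 : 0 ≤ T := (hε.trans (hεΛ _)).trans hT
  have hφ : MemLp (fun θ ↦ (Pi.single k ((Icc (-ε) 0).indicator f θ) : Fin d → ℝ)) 1
      (volume.restrict (Icc (-Λ (lastIdx N)) 0)) := by
    have h1 : MemLp ((Icc (-ε) 0).indicator f) 1 (volume.restrict (Icc (-Λ (lastIdx N)) 0)) :=
      memLp_one_iff_integrable.2 ((integrable_indicator_iff measurableSet_Icc).2 hf).integrableOn
    exact (ContinuousLinearMap.single ℝ (fun _ : Fin d ↦ ℝ) k).comp_memLp' h1
  obtain ⟨u, -, x, hx, hxT⟩ := hctrl 0 _ MemLp.zero hφ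
  have hint : ∀ i, IntervalIntegrable (fun t ↦ (x t i : ℂ)) volume 0 T := fun i ↦ by
    have h1 : IntegrableOn (fun t ↦ (x t i : ℂ)) (Icc (-Λ (lastIdx N)) T) :=
      ((memLp_one_iff_integrable.1 hx.1).eval i).ofReal
    refine (h1.mono_set ?_).intervalIntegrable
    rw [uIcc_of_le hT0]
    exact Icc_subset_Icc_left (by linarith [hε.trans (hεΛ (lastIdx N))])
  -- The constant is an `L¹` norm of one trajectory, fixed before `p` is chosen.
  refine ⟨∑ i, ∫ t in (0 : ℝ)..T, ‖(x t i : ℂ)‖, fun p ↦ ?_⟩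
  have hnn : ∀ i, 0 ≤ ∫ t in (0 : ℝ)..T, ‖(x t i : ℂ)‖ := fun i ↦
    intervalIntegral.integral_nonneg hT0 fun _ _ ↦ norm_nonneg _
  rw [sub_vecMul_H_mul_integral hmono hε hεΛ hT hB k f hx hxT p, norm_neg, Finset.mul_sum,
    Finset.mul_sum _ _ (max _ _), Finset.sum_mul]
  refine (norm_sum_le _ _).trans (Finset.sum_le_sum fun i _ ↦ ?_)
  rw [mul_left_comm, norm_mul, mul_comm (max _ _), mul_assoc]
  refine mul_le_mul_of_nonneg_left ?_ (norm_nonneg _)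
  refine (norm_exp_mul_integral_le hT0 (hint i) p).trans ?_
  refine mul_le_mul_of_nonneg_left ?_ (by positivity)
  exact Finset.single_le_sum (f := fun i ↦ ∫ t in (0 : ℝ)..T, ‖(x t i : ℂ)‖)
    (fun i _ ↦ hnn i) (Finset.mem_univ i)

/-- Exact controllability forces a quantitative Hautus estimate, by the uniform boundedness
principle. -/
theorem exists_norm_sub_vecMul_H_le {d m N : ℕ} [NeZero N]
    {A : Fin N → Matrix (Fin d) (Fin d) ℝ} {B : Matrix (Fin d) (Fin m) ℝ}
    {Λ : Fin N → ℝ} (hpos : ∀ j, 0 < Λ j) (hmono : StrictMono Λ) {T : ℝ}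
    (hT : Λ (lastIdx N) ≤ T) (hctrl : ExactlyControllable 1 A Λ B T) {w : Fin d → ℂ}
    (hB : Matrix.vecMul w (B.map (fun r : ℝ ↦ (r : ℂ))) = 0) (k : Fin d) :
    ∃ C : ℝ, 0 ≤ C ∧ ∀ p : ℂ, ‖w k - Matrix.vecMul w (H A Λ p) k‖ ≤
      C * (max 1 (Real.exp (p.re * T)) * ∑ i, ‖Matrix.vecMul w (H A Λ p) i‖) := by
  -- The smallest delay serves as `ε`.
  obtain ⟨ε, hε, hεΛ⟩ : ∃ ε : ℝ, 0 < ε ∧ ∀ j, ε ≤ Λ j :=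
    ⟨Λ 0, hpos 0, fun j ↦ hmono.monotone (Fin.zero_le j)⟩
  set c : ℂ → ℂ := fun p ↦ w k - Matrix.vecMul w (H A Λ p) k with hc
  set D : ℂ → ℝ := fun p ↦
    max 1 (Real.exp (p.re * T)) * ∑ i, ‖Matrix.vecMul w (H A Λ p) i‖ with hD
  have hD0 : ∀ p, 0 ≤ D p := fun p ↦ by positivity
  have hpt : ∀ f, ∃ K : ℝ, 0 ≤ K ∧ ∀ p, ‖c p * expPairing ε p f‖ ≤ D p * K := by
    intro f
    have hf : IntegrableOn f (Icc (-ε) 0) := L1.integrable_coeFn f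
    obtain ⟨K₁, h1⟩ := exists_norm_sub_vecMul_H_mul_integral_le hmono hε.le hεΛ hT hctrl hB k hf.re
    obtain ⟨K₂, h2⟩ := exists_norm_sub_vecMul_H_mul_integral_le hmono hε.le hεΛ hT hctrl hB k hf.im
    refine ⟨|K₁| + |K₂|, by positivity, fun p ↦ ?_⟩
    -- The system is real, so the real and imaginary parts of `f` are steered separately.
    have hsplit : expPairing ε p f =
        (∫ θ in Icc (-ε) 0, Complex.exp (-p * θ) * ((f θ).re : ℂ)) +
        Complex.I * ∫ θ in Icc (-ε) 0, Complex.exp (-p * θ) * ((f θ).im : ℂ) := by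
      rw [expPairing_apply, ← integral_const_mul, ← integral_add]
      · refine integral_congr_ae (Filter.Eventually.of_forall fun θ ↦ ?_)
        simp only
        nth_rewrite 1 [← Complex.re_add_im (f θ)]
        ring
      · exact IntegrableOn.continuousOn_mul (by fun_prop) hf.re.ofReal isCompact_Icc
      · exact (IntegrableOn.continuousOn_mul (by fun_prop) hf.im.ofReal isCompact_Icc).const_mul _
    rw [hsplit, mul_add, mul_left_comm, mul_add (D p)]
    refine (norm_add_le _ _).trans (add_le_add ?_ ?_)
    · exact (h1 p).trans (mul_le_mul_of_nonneg_left (le_abs_self _) (hD0 p))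
    · rw [norm_mul, Complex.norm_I, one_mul]
      exact (h2 p).trans (mul_le_mul_of_nonneg_left (le_abs_self _) (hD0 p))
  -- `D p` may vanish, so the functionals are normalized by every `s > D p`; letting `s` decrease to
  -- `D p` afterwards gives the bound.
  obtain ⟨C, hC⟩ := banach_steinhaus
    (g := fun q : {q : ℂ × ℝ // D q.1 < q.2} ↦ (c q.1.1 / (q.1.2 : ℂ)) • expPairing ε q.1.1)
    (fun f ↦ by
      obtain ⟨K, hK0, hK⟩ := hpt f
      refine ⟨K, fun ⟨⟨p, s⟩, hs⟩ ↦ ?_⟩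
      have hs0 : 0 < s := (hD0 p).trans_lt hs
      rw [smul_apply, smul_eq_mul, div_mul_eq_mul_div, norm_div,
        Complex.norm_real, Real.norm_of_nonneg hs0.le, div_le_iff₀ hs0, mul_comm K]
      exact (hK p).trans (mul_le_mul_of_nonneg_right hs.le hK0))
  have hC1 : 0 < max C 1 * Real.exp 1 := by positivity
  refine ⟨max C 1 * Real.exp 1, hC1.le, fun p ↦ ?_⟩
  rw [← div_le_iff₀' hC1]
  refine le_of_forall_gt_imp_ge_of_dense fun s hs ↦ ?_
  rw [div_le_iff₀' hC1]
  have hs0 : 0 < s := (hD0 p).trans_lt hs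
  obtain ⟨f, hf0, hf⟩ := exists_le_norm_expPairing hε p
  have h1 := ((c p / (s : ℂ)) • expPairing ε p).le_of_opNorm_le
    ((hC ⟨(p, s), hs⟩).trans (le_max_left C 1)) f
  rw [smul_apply, smul_eq_mul, div_mul_eq_mul_div, norm_div, norm_mul,
    Complex.norm_real, Real.norm_of_nonneg hs0.le, div_le_iff₀ hs0] at h1
  have h2 : ‖c p‖ * ‖expPairing ε p f‖ ≤
      (max C 1 * Real.exp 1 * s) * ‖expPairing ε p f‖ := by
    refine h1.trans ?_
    have h3 := mul_le_mul_of_nonneg_left hf (by positivity : 0 ≤ max C 1 * s)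
    linarith
  exact le_of_mul_le_mul_right h2 hf0

/-! ### Passage to the closure and conclusion. -/

/-- `H(p)` tends to the identity as the real part of `p` tends to infinity. -/
theorem exists_norm_sub_vecMul_H_le_of_re_ge {d N : ℕ}
    (A : Fin N → Matrix (Fin d) (Fin d) ℝ) {Λ : Fin N → ℝ} (hpos : ∀ j, 0 < Λ j)
    (w : Fin d → ℂ) (k : Fin d) {η : ℝ} (hη : 0 < η) :
    ∃ R : ℝ, ∀ p : ℂ, R ≤ p.re → ‖w k - Matrix.vecMul w (H A Λ p) k‖ < η := by
  set a : Fin N → ℝ := fun j ↦ ‖Matrix.vecMul w ((A j).map (fun r : ℝ ↦ (r : ℂ))) k‖ with ha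
  have hlim : Filter.Tendsto (fun R : ℝ ↦ ∑ j, Real.exp (-(R * Λ j)) * a j) Filter.atTop
      (nhds (∑ j, 0 * a j)) := by
    refine tendsto_finsetSum _ fun j _ ↦ Filter.Tendsto.mul_const _ ?_
    exact Real.tendsto_exp_neg_atTop_nhds_zero.comp (Filter.tendsto_id.atTop_mul_const (hpos j))
  simp only [zero_mul, Finset.sum_const_zero] at hlim
  obtain ⟨R, hR⟩ := Filter.eventually_atTop.1 (hlim.eventually_lt_const hη)
  refine ⟨R, fun p hp ↦ lt_of_le_of_lt ?_ (hR p.re hp)⟩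
  rw [vecMul_H, sub_sub_cancel]
  refine (norm_sum_le _ _).trans (Finset.sum_le_sum fun j _ ↦ ?_)
  rw [norm_mul, Complex.norm_exp]
  simp [ha]

/-- Near `M`, `w H(p)` is small, so `p` cannot lie in the half-plane where `H(p)` is close to the
identity. There `Re p < R` bounds the exponential factor, and the uniform estimate contradicts `w k
≠ 0`. -/
theorem vecMul_eq_zero_of_mem_closure {d m N : ℕ} [NeZero N]
    {A : Fin N → Matrix (Fin d) (Fin d) ℝ} {B : Matrix (Fin d) (Fin m) ℝ}
    {Λ : Fin N → ℝ} (hpos : ∀ j, 0 < Λ j) (hmono : StrictMono Λ) {T : ℝ}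
    (hT : Λ (lastIdx N) ≤ T) (hctrl : ExactlyControllable 1 A Λ B T)
    {M : Matrix (Fin d) (Fin d) ℂ} (hM : M ∈ closure (range (H A Λ))) (w : Fin d → ℂ)
    (hwM : Matrix.vecMul w M = 0)
    (hB : Matrix.vecMul w (B.map (fun r : ℝ ↦ (r : ℂ))) = 0) : w = 0 := by
  by_contra hw
  obtain ⟨k, hk⟩ := Function.ne_iff.1 hw
  have hk' : 0 < ‖w k‖ / 2 := half_pos (norm_pos_iff.2 hk)
  have hT0 : 0 ≤ T := (hpos _).le.trans hT
  obtain ⟨C, hC0, hC⟩ := exists_norm_sub_vecMul_H_le hpos hmono hT hctrl hB k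
  obtain ⟨R, hR⟩ := exists_norm_sub_vecMul_H_le_of_re_ge A hpos w k hk'
  have hcont : ∀ i, Continuous fun M : Matrix (Fin d) (Fin d) ℂ ↦ ‖Matrix.vecMul w M i‖ :=
    fun i ↦ ((continuous_apply i).comp (continuous_const.matrix_vecMul continuous_id)).norm
  have hev : ∀ᶠ M' in nhds M, ‖Matrix.vecMul w M' k‖ < ‖w k‖ / 2 ∧
      C * (max 1 (Real.exp (R * T)) * ∑ i, ‖Matrix.vecMul w M' i‖) < ‖w k‖ / 2 := by
    refine Filter.Eventually.and ?_ ?_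
    · refine (hcont k).continuousAt.eventually_lt_const ?_
      simpa [hwM] using hk'
    · have h1 : Continuous fun M' : Matrix (Fin d) (Fin d) ℂ ↦
          C * (max 1 (Real.exp (R * T)) * ∑ i, ‖Matrix.vecMul w M' i‖) :=
        ((continuous_finsetSum _ fun i _ ↦ hcont i).const_mul _).const_mul _
      refine h1.continuousAt.eventually_lt_const ?_
      simpa [hwM] using hk'
  obtain ⟨M', ⟨h1, h2⟩, p, rfl⟩ := mem_closure_iff_nhds.1 hM _ hev
  -- This lower bound both excludes `Re p ≥ R` and clashes with the uniform estimate.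
  have h3 : ‖w k‖ / 2 < ‖w k - Matrix.vecMul w (H A Λ p) k‖ := by
    linarith [norm_sub_norm_le (w k) (Matrix.vecMul w (H A Λ p) k)]
  have hp : p.re < R := by
    by_contra! hp
    exact lt_asymm h3 (hR p hp)
  have h4 : C * (max 1 (Real.exp (p.re * T)) * ∑ i, ‖Matrix.vecMul w (H A Λ p) i‖) ≤
      C * (max 1 (Real.exp (R * T)) * ∑ i, ‖Matrix.vecMul w (H A Λ p) i‖) := by
    gcongr
  linarith [hC p]

end DifferenceDelay

theorem theorem3p5 {d m N : ℕ} [NeZero d] [NeZero m] [NeZero N]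
    (A : Fin N → Matrix (Fin d) (Fin d) ℝ) (B : Matrix (Fin d) (Fin m) ℝ)
    (Λ : Fin N → ℝ) (hΛpos : ∀ j, 0 < Λ j) (hΛmono : StrictMono Λ)
    (hctrl : DifferenceDelay.ExactlyControllable 1 A Λ B
      ((d : ℝ) * Λ (DifferenceDelay.lastIdx N))) :
    (∀ M ∈ closure (Set.range (DifferenceDelay.H A Λ)),
      (Matrix.fromCols M (B.map (fun r : ℝ => (r : ℂ)))).rank = d) ∧
    (Matrix.fromCols (A (DifferenceDelay.lastIdx N)) B).rank = d := by
  -- The argument needs only a horizon of at least the longest delay, which `d ≥ 1` provides.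
  have hT : Λ (DifferenceDelay.lastIdx N) ≤ (d : ℝ) * Λ (DifferenceDelay.lastIdx N) :=
    le_mul_of_one_le_left (hΛpos _).le (by exact_mod_cast NeZero.one_le (n := d))
  refine ⟨fun M hM ↦ ?_, ?_⟩
  · exact DifferenceDelay.rank_fromCols_eq M _ fun w h1 h2 ↦
      DifferenceDelay.vecMul_eq_zero_of_mem_closure hΛpos hΛmono hT hctrl hM w h1 h2
  · exact DifferenceDelay.rank_fromCols_eq _ _ fun w h1 h2 ↦
      DifferenceDelay.vecMul_eq_zero_of_controllable hΛpos hΛmono hT hctrl w h1 h2
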